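/- Let $\Gamma$ be a finite graph (loops and multiple edges allowed) with vertex set $V$ and edge set $E$, with an arbitrary orientation of its edges, and let $T\subseteq E$ be a spanning tree; set $r=|T|$ and $R=\mathbb Z[q,q^{-1}]$. *Fundamental cuts and cycles.* For $e\in T$ let $V_{0,e}$ and $V_{1,e}$ be the vertex sets of the components of $T\setminus e$ containing the beginning and the end of $e$, respectively, and let $K_e\in\mathbb Z^E$ be the sum of the edges from $V_{0,e}$ to $V_{1,e}$ minus the sum of the edges from $V_{1,e}$ to $V_{0,e}$. For $f\in E\setminus T$ let $C_f\in\mathbb Z^E$ be the signed sum of the edges of the unique cycle in $T\cup f$, where the cycle is oriented by $f$ and an edge has sign $+1$ or $-1$ according to whether its orientation agrees with that of the cycle. Let $\langle\cdot,\cdot\rangle$ be the standard inner product on $\mathbb Z^E$. *The $q$-cut lattice.* Let $B=B_{\Gamma,T}$ be the signed bipartite graph with vertex set $E=T\sqcup (E\setminus T)$ in which $i\in T$ and $j\notin T$ are adjacent if $i$ occurs in $C_j$, with the sign $\epsilon_{ij}=\epsilon_{ji}=\pm1$ with which it occurs there; put $\epsilon_{ij}=0$ for non-adjacent $i,j$.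 Let $K_0$ be the free $R$-module with basis $[P_i]$, $i\in E$, and with the sesquilinear form $\langle\cdot,\cdot\rangle_q$ (antilinear with respect to $q\mapsto q^{-1}$ in the first argument, linear in the second) given by $$\langle [P_i],[P_j]\rangle_q=\delta_{ij}+q\,\epsilon_{ij}+\begin{cases}q^2\sum_{k\in T}\epsilon_{ik}\epsilon_{kj}&\text{if } i,j\notin T,\\ 0&\text{otherwise.}\end{cases}$$ (This is the graded signed dimension of $e_iA(B)e_j$, where $A(B)$ is the path algebra of the double quiver of $B$ modulo the paths of length two that start and end in $T$.) This Gram matrix is invertible over $R$; let $[L_j]$, $j\in E$, be the basis of $K_0$ with $\langle [P_i],[L_j]\rangle_q=\delta_{ij}$. The $q$-cut lattice $\mathcal C_q(\Gamma,T)$ is the $R$-submodule of $K_0$ generated by $[L_e]$, $e\in T$, with the restricted form. Let $G_{\mathcal C}=G_{\mathcal C}(q)$ be the matrix indexed by $T$ with $$(G_{\mathcal C})_{ee}=1+(\langle K_e,K_e\rangle-1)q^2,\qquad (G_{\mathcal C})_{ef}=\langle K_e,K_f\rangle q^2\quad(e\neq f).$$ **Theorem.** Let $c_i$ be the number of spanning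 trees $T'$ of $\Gamma$ with $|T'\cap T|=r-i$. Then: 1. $\displaystyle \det G_{\mathcal C}(q)=\sum_{i=0}^r c_i q^{2i}.$ 2. The elements $[L_e]$, $e\in T$, form a basis of $\mathcal C_q(\Gamma,T)$, and their Gram matrix is $G_{\mathcal C}$ up to the substitution $q\mapsto q^{-1}$: $\langle [L_e],[L_f]\rangle_q=(G_{\mathcal C})_{ef}(q^{-1})$ for all $e,f\in T$. 3. Hence, with the same substitution, the determinant of $\mathcal C_q(\Gamma,T)$ is $\sum_{i=0}^r c_i q^{2i}$: for every finite $R$-basis $(b_k)$ of $\mathcal C_q(\Gamma,T)$, the Laurent polynomial $\det\bigl(\langle b_k,b_l\rangle_q\bigr)$ becomes $\sum_{i=0}^r c_iq^{2i}$ when $q$ is replaced by $q^{-1}$. 4. $c_0=1$. -/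

import Mathlib

/-- A multigraph with vertex set `V` and edge set `E`, together with an orientation: the edge `e`
begins at `src e` and ends at `tgt e`.  Loops and multiple edges are allowed. -/
structure OrientedMultigraph (V E : Type*) where
  src : E → V
  tgt : E → V

namespace OrientedMultigraph

variable {V E : Type*}

/-- A step of a walk is a pair `(e, d)`: the edge `e` is traversed along its orientation if
`d = true` and against it if `d = false`.  `stepStart` is the vertex at which the step starts. -/
def stepStart (Γ : OrientedMultigraph V E) (p : E × Bool) : V :=
  if p.2 then Γ.src p.1 else Γ.tgt p.1

/-- The vertex at which a step arrives. -/
def stepEnd (Γ : OrientedMultigraph V E) (p : E × Bool) : V :=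
  if p.2 then Γ.tgt p.1 else Γ.src p.1

/-- `Γ.IsWalk u l v`: the list of steps `l` is a walk from `u` to `v` in the underlying
undirected graph. -/
def IsWalk (Γ : OrientedMultigraph V E) : V → List (E × Bool) → V → Prop
  | u, [], v => u = v
  | u, p :: l, v => Γ.stepStart p = u ∧ Γ.IsWalk (Γ.stepEnd p) l v

/-- There is a walk from `u` to `v` which uses only edges of `S`. -/
def Reach (Γ : OrientedMultigraph V E) (S : Finset E) (u v : V) : Prop :=
  ∃ l : List (E × Bool), (∀ p ∈ l, p.1 ∈ S) ∧ Γ.IsWalk u l v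

/-- `l` is a trail (a walk without repeated edges) from `u` to `v` which uses only edges of `S`. -/
def IsTrail (Γ : OrientedMultigraph V E) (S : Finset E) (u : V) (l : List (E × Bool)) (v : V) :
    Prop :=
  (∀ p ∈ l, p.1 ∈ S) ∧ (l.map Prod.fst).Nodup ∧ Γ.IsWalk u l v

/-- The edge set `S` is (the edge set of) a spanning tree: the graph with vertex set `V` and edge
set `S` is nonempty, connected, and contains no nonempty closed trail. -/
structure IsSpanningTree (Γ : OrientedMultigraph V E) (S : Finset E) : Prop where
  nonempty : Nonempty V
  connected : ∀ u v : V, Γ.Reach S u v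
  acyclic : ∀ (u : V) (l : List (E × Bool)), Γ.IsTrail S u l u → l = []

variable [DecidableEq E]

open Classical in
/-- The fundamental cut of `e ∈ T`.  Removing `e` from the spanning tree `T` leaves two components:
`V₀`, containing the beginning of `e`, and `V₁`, containing its end.  An edge of `Γ` has
coefficient `1` if it goes from `V₀` to `V₁`, `-1` if it goes from `V₁` to `V₀`, and `0`
otherwise. -/
noncomputable def fundCut (Γ : OrientedMultigraph V E) (T : Finset E) (e : E) : E → ℤ := fun e' =>
  if Γ.Reach (T.erase e) (Γ.src e) (Γ.src e') ∧ Γ.Reach (T.erase e) (Γ.tgt e) (Γ.tgt e') then 1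
  else if Γ.Reach (T.erase e) (Γ.tgt e) (Γ.src e') ∧ Γ.Reach (T.erase e) (Γ.src e) (Γ.tgt e') then
    -1
  else 0

open Classical in
/-- The trail from `u` to `v` in `T` (unique if `T` is a spanning tree). -/
noncomputable def treeTrail (Γ : OrientedMultigraph V E) (T : Finset E) (u v : V) :
    List (E × Bool) :=
  if h : ∃ l, Γ.IsTrail T u l v then h.choose else []

/-- The fundamental cycle of `f ∉ T`: first `f`, in its own direction, and then the trail in `T`
back from the end of `f` to its beginning.  Edges count with sign `1` if they are traversed along
their orientation and with sign `-1` otherwise. -/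
noncomputable def fundCycle (Γ : OrientedMultigraph V E) (T : Finset E) (f : E) : E → ℤ :=
  Pi.single f 1 +
    ((Γ.treeTrail T (Γ.tgt f) (Γ.src f)).map
      fun p => (Pi.single p.1 (if p.2 then 1 else -1) : E → ℤ)).sum

/-- The signed adjacency matrix of the signed bipartite graph `B` of `(Γ, T)`.  The vertices of
`B` are the edges of `Γ`, with parts `T` and `E ∖ T`; vertices `i ∈ T` and `j ∉ T` are joined if
`i` occurs in the fundamental cycle of `j`, and the sign of the edge is the sign with which `i`
occurs there. -/
noncomputable def bipSign (Γ : OrientedMultigraph V E) (T : Finset E) (i j : E) : ℤ :=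
  if i ∈ T ∧ j ∉ T then Γ.fundCycle T j i
  else if i ∉ T ∧ j ∈ T then Γ.fundCycle T i j
  else 0

variable [Fintype E]

/-- The matrix of the pairings `⟨[P_i], [P_j]⟩`, that is, the graded dimension (with negative edges
counted as `-1`) of `e_i A(B) e_j`, where `A(B)` is the quotient of the path algebra of the double
quiver of `B` by the paths of length two which start and end in `T`.  The surviving paths from `i`
to `j` are the constant paths, the edges, and the paths of length two which start and end outside
`T` (their middle vertex is then in `T`). -/
noncomputable def eulerGram (Γ : OrientedMultigraph V E) (T : Finset E) :
    Matrix E E (LaurentPolynomial ℤ) := fun i j =>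
  (if i = j then 1 else 0)
    + LaurentPolynomial.C (Γ.bipSign T i j) * LaurentPolynomial.T 1
    + (if i ∉ T ∧ j ∉ T then
        LaurentPolynomial.C (∑ k ∈ T, Γ.bipSign T i k * Γ.bipSign T k j) * LaurentPolynomial.T 2
      else 0)

/-- The graded Euler form on `K₀`, which is the free module over `ℤ[q, q⁻¹]` on the classes `[P_i]`,
`i ∈ E`, written in this basis.  It is `q`-antilinear (for `q ↦ q⁻¹`) in the first argument and
linear in the second. -/
noncomputable def eulerForm (Γ : OrientedMultigraph V E) (T : Finset E)
    (x y : E → LaurentPolynomial ℤ) : LaurentPolynomial ℤ :=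
  ∑ i, ∑ j, LaurentPolynomial.invert (x i) * Γ.eulerGram T i j * y j

/-- The class `[L_j]`, in the basis of the `[P_i]`: the `j`-th column of the inverse of the Gram
matrix, i.e. the `j`-th element of the right dual basis of the `[P_i]`
(see `eulerForm_single_simpleClass`). -/
noncomputable def simpleClass (Γ : OrientedMultigraph V E) (T : Finset E) (j : E) :
    E → LaurentPolynomial ℤ := fun i => (Γ.eulerGram T)⁻¹ i j

/-- The `q`-cut lattice: the submodule of `K₀` generated by the classes `[L_e]`, `e ∈ T`.  It carries
the restriction of `eulerForm`. -/
noncomputable def qCutLattice (Γ : OrientedMultigraph V E) (T : Finset E) :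
    Submodule (LaurentPolynomial ℤ) (E → LaurentPolynomial ℤ) :=
  Submodule.span (LaurentPolynomial ℤ) {x | ∃ e ∈ T, x = Γ.simpleClass T e}

/-- The combinatorial Gram matrix of the `q`-cut lattice, indexed by the edges of `T`:
`1 + (⟨K_e, K_e⟩ - 1) q²` on the diagonal and `⟨K_e, K_f⟩ q²` off the diagonal, for the fundamental
cuts `K_e` and the standard inner product of `ℤ^E`. -/
noncomputable def qCutGram (Γ : OrientedMultigraph V E) (T : Finset E) :
    Matrix T T (LaurentPolynomial ℤ) := fun e f =>
  if e = f then
    1 + LaurentPolynomial.C ((Γ.fundCut T e ⬝ᵥ Γ.fundCut T e) - 1) * LaurentPolynomial.T 2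
  else
    LaurentPolynomial.C (Γ.fundCut T e ⬝ᵥ Γ.fundCut T f) * LaurentPolynomial.T 2

/-- The number of spanning trees `T'` of `Γ` with `|T' ∩ T| = |T| - i`. -/
noncomputable def treeCount (Γ : OrientedMultigraph V E) (T : Finset E) (i : ℕ) : ℕ :=
  Set.ncard {T' : Finset E | Γ.IsSpanningTree T' ∧ (T' ∩ T).card + i = T.card}

/-- The unitriangular factor of `eulerGram`. -/
noncomputable def halfGram (Γ : OrientedMultigraph V E) (T : Finset E) :
    Matrix E E (LaurentPolynomial ℤ) := fun i j =>
  if i ∈ T ∧ j ∉ T then LaurentPolynomial.C (Γ.bipSign T i j) * LaurentPolynomial.T 1 else 0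

theorem bipSign_comm (Γ : OrientedMultigraph V E) (T : Finset E) (i j : E) :
    Γ.bipSign T i j = Γ.bipSign T j i := by
  unfold bipSign
  by_cases hi : i ∈ T <;> by_cases hj : j ∈ T <;> simp [hi, hj]

theorem halfGram_sq (Γ : OrientedMultigraph V E) (T : Finset E) :
    Γ.halfGram T * Γ.halfGram T = 0 := by
  ext1 i j
  rw [Matrix.mul_apply]
  refine Finset.sum_eq_zero fun k _ => ?_
  unfold halfGram
  by_cases hk : k ∈ T <;> simp [hk]

theorem eulerGram_eq (Γ : OrientedMultigraph V E) (T : Finset E) :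
    Γ.eulerGram T = (1 + (Γ.halfGram T).transpose) * (1 + Γ.halfGram T) := by
  ext1 i j
  rw [add_mul, one_mul, mul_add, mul_one, Matrix.add_apply, Matrix.add_apply, Matrix.add_apply,
    Matrix.mul_apply, Matrix.one_apply, Matrix.transpose_apply]
  have h2 : (LaurentPolynomial.T 2 : LaurentPolynomial ℤ)
      = LaurentPolynomial.T 1 * LaurentPolynomial.T 1 := by
    rw [← LaurentPolynomial.T_add]; norm_num
  have hs : ∑ k, (Γ.halfGram T).transpose i k * Γ.halfGram T k j =
      if i ∉ T ∧ j ∉ T then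
        LaurentPolynomial.C (∑ k ∈ T, Γ.bipSign T i k * Γ.bipSign T k j) * LaurentPolynomial.T 2
      else 0 := by
    split_ifs with h
    · rw [map_sum, Finset.sum_mul, ← Finset.sum_subset (Finset.subset_univ T)]
      · refine Finset.sum_congr rfl fun k hk => ?_
        simp only [Matrix.transpose_apply, halfGram, hk, h.1, h.2, not_false_eq_true, and_self,
          if_true, map_mul, h2, Γ.bipSign_comm T i k]
        ring
      · intro k _ hk
        simp [halfGram, hk]
    · refine Finset.sum_eq_zero fun k _ => ?_
      simp only [Matrix.transpose_apply, halfGram]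
      by_cases hi : i ∈ T
      · simp [hi]
      · have hj : j ∈ T := by
          by_contra hj
          exact h ⟨hi, hj⟩
        simp [hj]
  rw [hs]
  unfold eulerGram
  have hm : LaurentPolynomial.C (Γ.bipSign T i j) * LaurentPolynomial.T 1
      = Γ.halfGram T i j + Γ.halfGram T j i := by
    rw [halfGram, halfGram, Γ.bipSign_comm T j i]
    by_cases hi : i ∈ T <;> by_cases hj : j ∈ T <;> simp [hi, hj, bipSign]
  rw [hm]
  ring

theorem eulerGram_mul_inv (Γ : OrientedMultigraph V E) (T : Finset E) :
    Γ.eulerGram T * (Γ.eulerGram T)⁻¹ = 1 := by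
  have h1 : (1 + Γ.halfGram T) * (1 - Γ.halfGram T) = 1 := by
    rw [add_mul, mul_sub, mul_sub, Γ.halfGram_sq T]; simp
  have hu : IsUnit (1 + Γ.halfGram T).det :=
    (Matrix.isUnit_iff_isUnit_det _).1 (IsUnit.of_mul_eq_one _ h1)
  refine Matrix.mul_nonsing_inv _ ?_
  rw [Γ.eulerGram_eq T, Matrix.det_mul]
  refine IsUnit.mul ?_ hu
  have : (1 + (Γ.halfGram T).transpose) = (1 + Γ.halfGram T).transpose := by simp
  rw [this, Matrix.det_transpose]
  exact hu

/-- The classes `[L_j]` form the right dual basis of the classes `[P_i]`. -/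
theorem eulerForm_single_simpleClass (Γ : OrientedMultigraph V E) (T : Finset E) (i j : E) :
    Γ.eulerForm T (Pi.single i 1) (Γ.simpleClass T j) = if i = j then 1 else 0 := by
  have h := congrFun (congrFun (Γ.eulerGram_mul_inv T) i) j
  rw [Matrix.mul_apply, Matrix.one_apply] at h
  rw [← h, eulerForm, Finset.sum_eq_single i]
  · simp [simpleClass]
  · intro k _ hk
    simp [hk]
  · simp

end OrientedMultigraph

/-! Each fundamental cut `K_e` is the coboundary of the indicator of one side of the cut, and it
restricts to `δ_e` on `T`. So, with `M` the `T × E` matrix of cuts and `D` diagonal with weight `1`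
on `T` and `q²` off `T`, the matrix `G_C` is `M D Mᵀ`. Cauchy-Binet turns its determinant into a sum
of `(det M_S)² q^(2|S \ T|)` over `|T|`-subsets `S`. The minor is `±1` for a spanning tree (`M_S` is
an integral change of basis between two bases of cuts). Otherwise it is `0`: a component of a
disconnected `S` gives a left kernel vector, a closed trail in `S` a right one (`sq_det_fundCut`).

On the algebraic side the Euler matrix is `(1 + Nᵀ)(1 + N)` with `N² = 0`, so its inverse is `(1 -
N)(1 - Nᵀ)`, whose `T`-block is `1 + N Nᵀ`. Orthogonality of cuts and cycles gives `N_ej = -q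
K_e(j)`, so this block is `G_C`; antilinearity in the first argument accounts for `q ↦ q⁻¹`. A
change of basis multiplies the Gram determinant by `ū u` for a unit `u = ±qⁿ`, that is, by `1`. -/

namespace OrientedMultigraph

/-! ### Walks, trails and coboundaries -/

section Walks

variable {V E : Type*} {Γ : OrientedMultigraph V E} {S : Finset E}

theorem isWalk_append {u v : V} {l₁ l₂ : List (E × Bool)} :
    Γ.IsWalk u (l₁ ++ l₂) v ↔ ∃ w, Γ.IsWalk u l₁ w ∧ Γ.IsWalk w l₂ v := by
  induction l₁ generalizing u with
  | nil => simp [IsWalk]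
  | cons p l ih => simp [IsWalk, ih, and_assoc]

theorem Reach.refl (u : V) : Γ.Reach S u u := ⟨[], by simp, rfl⟩

theorem Reach.trans {u v w : V} (h₁ : Γ.Reach S u v) (h₂ : Γ.Reach S v w) : Γ.Reach S u w := by
  obtain ⟨l₁, hl₁, hw₁⟩ := h₁
  obtain ⟨l₂, hl₂, hw₂⟩ := h₂
  refine ⟨l₁ ++ l₂, fun p hp => ?_, isWalk_append.2 ⟨v, hw₁, hw₂⟩⟩
  rcases List.mem_append.1 hp with hp | hp
  exacts [hl₁ p hp, hl₂ p hp]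

theorem Reach.edge {e : E} (he : e ∈ S) : Γ.Reach S (Γ.src e) (Γ.tgt e) :=
  ⟨[(e, true)], by simpa using he, by simp [IsWalk, stepStart, stepEnd]⟩

theorem Reach.edge_symm {e : E} (he : e ∈ S) : Γ.Reach S (Γ.tgt e) (Γ.src e) :=
  ⟨[(e, false)], by simpa using he, by simp [IsWalk, stepStart, stepEnd]⟩

/-- A function on the vertices which is constant along the edges of `S` is constant on the
components of `S`. -/
theorem Reach.apply_eq {α : Sort*} {φ : V → α} (hφ : ∀ e ∈ S, φ (Γ.src e) = φ (Γ.tgt e)) {u v : V}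
    (h : Γ.Reach S u v) : φ u = φ v := by
  obtain ⟨l, hl, hw⟩ := h
  induction l generalizing u with
  | nil => rw [show u = v from hw]
  | cons p l ih =>
    rw [← hw.1, ← ih (fun p hp => hl p (List.mem_cons_of_mem _ hp)) hw.2]
    have := hφ p.1 (hl p List.mem_cons_self)
    obtain ⟨e, _ | _⟩ := p
    · simpa [stepStart, stepEnd] using this.symm
    · simpa [stepStart, stepEnd] using this

/-- No walk is reversed: being able to reach `u` is a `Prop`-valued potential, constant along the
edges of `S`. -/
theorem Reach.symm {u v : V} (h : Γ.Reach S u v) : Γ.Reach S v u := by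
  have : Γ.Reach S u u = Γ.Reach S v u :=
    Reach.apply_eq (φ := fun w => Γ.Reach S w u) (fun e he => propext
      ⟨fun h => (Reach.edge_symm he).trans h, fun h => (Reach.edge he).trans h⟩) h
  exact this ▸ Reach.refl u

theorem Reach.congr_src_tgt {e : E} (he : e ∈ S) (u : V) :
    Γ.Reach S u (Γ.src e) ↔ Γ.Reach S u (Γ.tgt e) :=
  ⟨fun h => h.trans (Reach.edge he), fun h => h.trans (Reach.edge_symm he)⟩

theorem Reach.exists_isTrail {u v : V} (h : Γ.Reach S u v) : ∃ l, Γ.IsTrail S u l v := by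
  obtain ⟨l, hl, hw⟩ := h
  induction l generalizing u with
  | nil => exact ⟨[], by simp, by simp, hw⟩
  | cons p l ih =>
    obtain ⟨l', hS, hn, hw'⟩ := ih (fun p hp => hl p (List.mem_cons_of_mem _ hp)) hw.2
    have hp := hl p List.mem_cons_self
    -- If the new edge recurs in the trail, shortcut to that occurrence: keep it if the direction
    -- agrees; otherwise it ends at `u`, and the trail can start right after it.
    by_cases hmem : p.1 ∈ l'.map Prod.fst
    · obtain ⟨⟨e, d⟩, hd, he⟩ := List.mem_map.1 hmem
      obtain ⟨l₁, l₂, rfl⟩ := List.append_of_mem hd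
      obtain ⟨w, -, -, hw₂⟩ := isWalk_append.1 hw'
      have hS₂ : ∀ p ∈ l₂, p.1 ∈ S := fun p hp => hS p (by simp [hp])
      rw [List.map_append, List.nodup_append, List.map_cons, List.nodup_cons] at hn
      by_cases hdp : d = p.2
      · obtain rfl : (e, d) = p := Prod.ext he hdp
        exact ⟨(e, d) :: l₂, List.forall_mem_cons.2 ⟨hp, hS₂⟩,
          by simpa using hn.2.1, hw.1, hw₂⟩
      · have hu : Γ.stepEnd (e, d) = u := by
          rw [← hw.1]
          obtain ⟨e', d'⟩ := p
          obtain rfl : e = e' := he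
          cases d <;> cases d' <;> simp_all [stepStart, stepEnd]
        exact ⟨l₂, hS₂, hn.2.1.2, hu ▸ hw₂⟩
    · exact ⟨p :: l', List.forall_mem_cons.2 ⟨hp, hS⟩, by
        simpa using ⟨by simpa using hmem, hn⟩, hw.1, hw'⟩

theorem IsSpanningTree.isTrail_treeTrail {T : Finset E} (hT : Γ.IsSpanningTree T) (u v : V) :
    Γ.IsTrail T u (Γ.treeTrail T u v) v := by
  have h := (hT.connected u v).exists_isTrail
  rw [treeTrail, dif_pos h]
  exact h.choose_spec

/-- The coboundary of a function on the vertices. -/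
def coboundary (Γ : OrientedMultigraph V E) (φ : V → ℤ) : E → ℤ :=
  fun e => φ (Γ.tgt e) - φ (Γ.src e)

variable [DecidableEq E]

/-- The signed sum of the edges of a walk. -/
def walkVec (l : List (E × Bool)) : E → ℤ :=
  (l.map fun p => (Pi.single p.1 (if p.2 then 1 else -1) : E → ℤ)).sum

theorem walkVec_cons (p : E × Bool) (l : List (E × Bool)) :
    walkVec (p :: l) = Pi.single p.1 (if p.2 then 1 else -1) + walkVec l := by
  simp [walkVec]

theorem walkVec_apply_eq_zero {l : List (E × Bool)} {e : E} (he : e ∉ l.map Prod.fst) :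
    walkVec l e = 0 := by
  induction l with
  | nil => simp [walkVec]
  | cons p l ih =>
    rw [List.map_cons, List.mem_cons, not_or] at he
    rw [walkVec_cons, Pi.add_apply, ih he.2, Pi.single_eq_of_ne he.1, add_zero]

/-- Telescoping sum. For a closed walk it says that cuts are orthogonal to cycles. -/
theorem coboundary_dotProduct_walkVec [Fintype E] (φ : V → ℤ) {u v : V} {l : List (E × Bool)}
    (h : Γ.IsWalk u l v) : Γ.coboundary φ ⬝ᵥ walkVec l = φ v - φ u := by
  induction l generalizing u with
  | nil => simp [walkVec, show u = v from h]
  | cons p l ih =>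
    rw [walkVec_cons, dotProduct_add, ih h.2, dotProduct_single, ← h.1]
    obtain ⟨e, _ | _⟩ := p <;> simp [coboundary, stepStart, stepEnd]

end Walks

/-! ### Fundamental cuts, their duality with cycles, and their maximal minors -/

section SpanningTree

variable {V E : Type*} {Γ : OrientedMultigraph V E} {S T : Finset E} [DecidableEq E]

open Classical in
/-- The indicator function of the component of `T ∖ e` which contains the end of `e`. -/
noncomputable def cutPotential (Γ : OrientedMultigraph V E) (T : Finset E) (e : E) : V → ℤ :=
  fun v => if Γ.Reach (T.erase e) (Γ.tgt e) v then 1 else 0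

namespace IsSpanningTree

/-- Otherwise `e` followed by a trail back in `T ∖ e` would be a nonempty closed trail in `T`. -/
theorem not_reach_erase (hT : Γ.IsSpanningTree T) {e : E} (he : e ∈ T) :
    ¬ Γ.Reach (T.erase e) (Γ.tgt e) (Γ.src e) := by
  intro h
  obtain ⟨l, hS, hn, hw⟩ := h.exists_isTrail
  have := hT.acyclic (Γ.src e) ((e, true) :: l) ⟨fun p hp => ?_, ?_, ?_, hw⟩
  · simp at this
  · rcases List.mem_cons.1 hp with rfl | hp
    exacts [he, Finset.mem_of_mem_erase (hS p hp)]
  · rw [List.map_cons, List.nodup_cons]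
    refine ⟨fun hmem => ?_, hn⟩
    obtain ⟨p, hp, hpe⟩ := List.mem_map.1 hmem
    exact Finset.ne_of_mem_erase (hS p hp) hpe
  · simp [stepStart]

theorem reach_erase_or (hT : Γ.IsSpanningTree T) (e : E) (v : V) :
    Γ.Reach (T.erase e) (Γ.src e) v ∨ Γ.Reach (T.erase e) (Γ.tgt e) v := by
  have := Reach.apply_eq (φ := fun v => Γ.Reach (T.erase e) (Γ.src e) v ∨
    Γ.Reach (T.erase e) (Γ.tgt e) v) (fun e' he' => ?_) (hT.connected (Γ.src e) v)
  · exact this ▸ Or.inl (Reach.refl _)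
  · by_cases h : e' = e
    · subst h
      simp [Reach.refl]
    · have h' : e' ∈ T.erase e := Finset.mem_erase.2 ⟨h, he'⟩
      simp only [Reach.congr_src_tgt h']

theorem reach_erase_src_iff (hT : Γ.IsSpanningTree T) {e : E} (he : e ∈ T) (v : V) :
    Γ.Reach (T.erase e) (Γ.src e) v ↔ ¬ Γ.Reach (T.erase e) (Γ.tgt e) v :=
  ⟨fun h h' => hT.not_reach_erase he (h'.trans h.symm), (hT.reach_erase_or e v).resolve_right⟩

theorem fundCut_eq (hT : Γ.IsSpanningTree T) {e : E} (he : e ∈ T) :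
    Γ.fundCut T e = Γ.coboundary (Γ.cutPotential T e) := by
  classical
  ext e'
  simp only [fundCut, coboundary, cutPotential, hT.reach_erase_src_iff he]
  split_ifs <;> simp_all

theorem fundCut_apply (hT : Γ.IsSpanningTree T) {e e' : E} (he : e ∈ T) (he' : e' ∈ T) :
    Γ.fundCut T e e' = if e = e' then 1 else 0 := by
  classical
  rw [hT.fundCut_eq he]
  simp only [coboundary, cutPotential]
  by_cases h : e = e'
  · subst h
    simp [Reach.refl, hT.not_reach_erase he]
  · have h' : e' ∈ T.erase e := Finset.mem_erase.2 ⟨Ne.symm h, he'⟩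
    rw [if_neg h, sub_eq_zero]
    exact if_congr (Reach.congr_src_tgt h' _).symm rfl rfl

/-- The fundamental cuts of a spanning tree generate all coboundaries. -/
theorem coboundary_eq_sum (hT : Γ.IsSpanningTree T) (φ : V → ℤ) :
    Γ.coboundary φ = ∑ e ∈ T, Γ.coboundary φ e • Γ.fundCut T e := by
  -- The coboundary of `ψ` vanishes on `T`, since `K_e` restricts to `δ_e` there; as `T` is
  -- connected, `ψ` is constant.
  set ψ : V → ℤ := φ - ∑ e ∈ T, Γ.coboundary φ e • Γ.cutPotential T e with hψ
  have key : Γ.coboundary ψ = Γ.coboundary φ - ∑ e ∈ T, Γ.coboundary φ e • Γ.fundCut T e := by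
    rw [Finset.sum_congr rfl fun e he => by rw [hT.fundCut_eq he]]
    ext e'
    simp only [hψ, coboundary, Pi.sub_apply, Finset.sum_apply, Pi.smul_apply, smul_eq_mul, mul_sub,
      Finset.sum_sub_distrib]
    ring
  have hconst : ∀ e ∈ T, ψ (Γ.src e) = ψ (Γ.tgt e) := by
    intro e he
    have : Γ.coboundary ψ e = 0 := by
      rw [key, Pi.sub_apply, Finset.sum_apply, Finset.sum_eq_single e]
      · simp [hT.fundCut_apply he he]
      · intro e' he' hne
        simp [hT.fundCut_apply he' he, hne]
      · exact fun h => absurd he h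
    exact (sub_eq_zero.1 this).symm
  rw [← sub_eq_zero, ← key]
  ext e
  exact sub_eq_zero.2 (Reach.apply_eq hconst (hT.connected _ _)).symm

theorem fundCut_eq_sum (hT : Γ.IsSpanningTree T) (hS : Γ.IsSpanningTree S) {e : E} (he : e ∈ T)
    (e' : E) : Γ.fundCut T e e' = ∑ s ∈ S, Γ.fundCut T e s * Γ.fundCut S s e' := by
  have := congrFun (hS.coboundary_eq_sum (Γ.cutPotential T e)) e'
  rw [← hT.fundCut_eq he, Finset.sum_apply] at this
  simpa using this

/-- Expressing the cuts of `T` in those of `S` and back gives mutually inverse matrices; hence all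
spanning trees have the same size. -/
theorem fundCut_mul_fundCut (hT : Γ.IsSpanningTree T) (hS : Γ.IsSpanningTree S) :
    (Matrix.of fun (e : T) (s : S) => Γ.fundCut T e s) *
      (Matrix.of fun (s : S) (e : T) => Γ.fundCut S s e) = 1 := by
  ext e e'
  rw [Matrix.mul_apply, Matrix.one_apply]
  simp only [Matrix.of_apply]
  rw [Finset.sum_coe_sort S fun s => Γ.fundCut T e s * Γ.fundCut S s e',
    ← hT.fundCut_eq_sum hS e.2, hT.fundCut_apply e.2 e'.2]
  exact if_congr Subtype.ext_iff.symm rfl rfl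

theorem card_eq (hT : Γ.IsSpanningTree T) (hS : Γ.IsSpanningTree S) : S.card = T.card := by
  have := Matrix.square_of_invertible _ _ (hT.fundCut_mul_fundCut hS) (hS.fundCut_mul_fundCut hT)
  simpa using this.symm

theorem eq_of_subset (hT : Γ.IsSpanningTree T) (hS : Γ.IsSpanningTree S) (h : T ⊆ S) : S = T :=
  (Finset.eq_of_subset_of_card_le h (hT.card_eq hS).le).symm

/-- The square of a maximal minor of the matrix of fundamental cuts. -/
theorem sq_det_fundCut_of_isSpanningTree (hT : Γ.IsSpanningTree T) {f : T → E}
    (hf : Function.Injective f) (hS : Γ.IsSpanningTree (Finset.univ.image f)) :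
    (Matrix.of fun e t : T => Γ.fundCut T e (f t)).det ^ 2 = 1 := by
  set S := Finset.univ.image f with hSdef
  -- The minor has an integral inverse, the cuts of `S` evaluated on `T`, so its determinant is a
  -- unit of `ℤ`.
  have h : (Matrix.of fun e t : T => Γ.fundCut T e (f t)) *
      (Matrix.of fun t e : T => Γ.fundCut S (f t) e) = 1 := by
    ext e e'
    rw [Matrix.mul_apply, Matrix.one_apply]
    simp only [Matrix.of_apply]
    rw [← Finset.sum_image (s := Finset.univ) (g := f)
      (f := fun s => Γ.fundCut T e s * Γ.fundCut S s e') hf.injOn,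
      ← hT.fundCut_eq_sum hS e.2, hT.fundCut_apply e.2 e'.2]
    exact if_congr Subtype.ext_iff.symm rfl rfl
  have hdet := congrArg Matrix.det h
  rw [Matrix.det_mul, Matrix.det_one] at hdet
  rcases Int.isUnit_iff.1 (IsUnit.of_mul_eq_one _ hdet) with h | h <;> simp [h]

/-- The coboundary of the indicator of the component of `u` vanishes on the image of `f`, but not on
all of `T`, which connects `u` to `v`. Its coordinates in the fundamental cuts form a left kernel
vector. -/
theorem det_fundCut_of_not_connected (hT : Γ.IsSpanningTree T) {f : T → E} {u v : V}
    (huv : ¬ Γ.Reach (Finset.univ.image f) u v) :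
    (Matrix.of fun e t : T => Γ.fundCut T e (f t)).det = 0 := by
  classical
  set S := Finset.univ.image f with hSdef
  set φ : V → ℤ := fun w => if Γ.Reach S u w then 1 else 0 with hφ
  refine Matrix.exists_vecMul_eq_zero_iff.1 ⟨fun e => Γ.coboundary φ e, fun h0 => ?_, ?_⟩
  · have := Reach.apply_eq (φ := φ) (fun e he => ?_) (hT.connected u v)
    · simp [hφ, huv, Reach.refl] at this
    · exact (sub_eq_zero.1 (congrFun h0 ⟨e, he⟩)).symm
  · ext t
    have h1 := congrFun (hT.coboundary_eq_sum φ) (f t)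
    have h2 : Γ.coboundary φ (f t) = 0 := by
      have hmem : f t ∈ S := Finset.mem_image_of_mem f (Finset.mem_univ t)
      exact sub_eq_zero.2 (if_congr (Reach.congr_src_tgt hmem _).symm rfl rfl)
    rw [h2, Finset.sum_apply] at h1
    simp only [Matrix.vecMul, dotProduct, Matrix.of_apply, Pi.zero_apply]
    rw [Finset.sum_coe_sort T fun e => Γ.coboundary φ e * Γ.fundCut T e (f t)]
    simpa using h1.symm

variable [Fintype E]

theorem fundCut_dotProduct_walkVec (hT : Γ.IsSpanningTree T) {e : E} (he : e ∈ T) {u : V}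
    {l : List (E × Bool)} (hl : Γ.IsWalk u l u) : Γ.fundCut T e ⬝ᵥ walkVec l = 0 := by
  rw [hT.fundCut_eq he, coboundary_dotProduct_walkVec _ hl, sub_self]

/-- The duality of fundamental cuts and fundamental cycles. -/
theorem fundCycle_apply (hT : Γ.IsSpanningTree T) {e f : E} (he : e ∈ T) (hf : f ∉ T) :
    Γ.fundCycle T f e = -Γ.fundCut T e f := by
  obtain ⟨hS, -, hw⟩ := hT.isTrail_treeTrail (Γ.tgt f) (Γ.src f)
  set l := Γ.treeTrail T (Γ.tgt f) (Γ.src f) with hl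
  have hC : Γ.fundCycle T f = Pi.single f 1 + walkVec l := rfl
  have hsupp : ∀ e' ∉ T, walkVec l e' = 0 := fun e' he' => walkVec_apply_eq_zero fun h => by
    obtain ⟨p, hp, rfl⟩ := List.mem_map.1 h
    exact he' (hS p hp)
  -- In the pairing of `K_e` with the closed walk through `f`, only `f` itself and the edge `e`
  -- contribute.
  have h0 := hT.fundCut_dotProduct_walkVec he (u := Γ.src f) (l := (f, true) :: l)
    ⟨by simp [stepStart], by simpa [stepEnd] using hw⟩
  rw [walkVec_cons, dotProduct_add, dotProduct_single] at h0
  have h1 : Γ.fundCut T e ⬝ᵥ walkVec l = walkVec l e := by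
    rw [dotProduct, Finset.sum_eq_single e]
    · simp [hT.fundCut_apply he he]
    · intro e' _ hne
      by_cases he' : e' ∈ T
      · simp [hT.fundCut_apply he he', hne.symm]
      · simp [hsupp e' he']
    · simp
  rw [h1] at h0
  have hne : e ≠ f := fun h => hf (h ▸ he)
  rw [hC, Pi.add_apply, Pi.single_eq_of_ne hne]
  simp only [if_true, mul_one] at h0
  linarith

theorem bipSign_eq (hT : Γ.IsSpanningTree T) {e f : E} (he : e ∈ T) (hf : f ∉ T) :
    Γ.bipSign T e f = -Γ.fundCut T e f := by
  rw [bipSign, if_pos ⟨he, hf⟩, hT.fundCycle_apply he hf]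

/-- The signed edge sum of the trail is orthogonal to every cut and supported on the image of `f`.
It is nonzero because the first edge of a trail does not recur. -/
theorem det_fundCut_of_isTrail (hT : Γ.IsSpanningTree T) {f : T → E} (hf : Function.Injective f)
    {u : V} {l : List (E × Bool)} (hl : Γ.IsTrail (Finset.univ.image f) u l u) (hne : l ≠ []) :
    (Matrix.of fun e t : T => Γ.fundCut T e (f t)).det = 0 := by
  obtain ⟨hS, hn, hw⟩ := hl
  refine Matrix.exists_mulVec_eq_zero_iff.1 ⟨fun t => walkVec l (f t), fun h0 => ?_, ?_⟩
  · obtain ⟨p, l', rfl⟩ := List.exists_cons_of_ne_nil hne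
    obtain ⟨t, -, ht⟩ := Finset.mem_image.1 (hS p List.mem_cons_self)
    have := congrFun h0 t
    rw [List.map_cons, List.nodup_cons] at hn
    simp only [ht, walkVec_cons, Pi.add_apply, Pi.single_eq_same, walkVec_apply_eq_zero hn.1,
      Pi.zero_apply] at this
    split_ifs at this <;> simp at this
  · ext e
    rw [Pi.zero_apply, ← hT.fundCut_dotProduct_walkVec e.2 hw]
    simp only [Matrix.mulVec, dotProduct, Matrix.of_apply]
    rw [← Finset.sum_image (s := Finset.univ) (g := f)
      (f := fun s => Γ.fundCut T e s * walkVec l s) hf.injOn]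
    refine Finset.sum_subset (Finset.subset_univ _) fun s _ hs => ?_
    rw [walkVec_apply_eq_zero, mul_zero]
    intro h
    obtain ⟨p, hp, rfl⟩ := List.mem_map.1 h
    exact hs (hS p hp)

open Classical in
theorem sq_det_fundCut (hT : Γ.IsSpanningTree T) (f : T → E) :
    (Matrix.of fun e t : T => Γ.fundCut T e (f t)).det ^ 2 =
      if Function.Injective f ∧ Γ.IsSpanningTree (Finset.univ.image f) then 1 else 0 := by
  split_ifs with h
  · exact hT.sq_det_fundCut_of_isSpanningTree h.1 h.2
  · suffices (Matrix.of fun e t : T => Γ.fundCut T e (f t)).det = 0 by simp [this]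
    by_cases hf : Function.Injective f
    · by_contra hdet
      refine h ⟨hf, hT.nonempty, fun u v => ?_, fun u l hl => ?_⟩
      · by_contra huv
        exact hdet (hT.det_fundCut_of_not_connected huv)
      · by_contra hne
        exact hdet (hT.det_fundCut_of_isTrail hf hl hne)
    · obtain ⟨i, j, hij, hne⟩ := Function.not_injective_iff.1 hf
      exact Matrix.det_zero_of_column_eq hne fun k => by simp [hij]

end IsSpanningTree

end SpanningTree

end OrientedMultigraph

/-! ### The Cauchy-Binet formula -/

section CauchyBinet

variable {m n R : Type*} [Fintype m] [DecidableEq m] [Fintype n] [CommRing R]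

namespace Matrix

/-- The rows of `A * B` are combinations of rows of `B`; expand the determinant multilinearly. -/
theorem det_mul_eq_sum_prod_mul_det (A : Matrix m n R) (B : Matrix n m R) :
    (A * B).det = ∑ f : m → n, (∏ i, A i (f i)) * (B.submatrix f id).det := by
  classical
  have h : A * B = fun i => ∑ j, A i j • B j := by
    ext i k
    simp [mul_apply]
  have h2 := (detRowAlternating (n := m) (R := R)).toMultilinearMap.map_sum
    (fun i (j : n) => A i j • B j)
  rw [h]
  refine h2.trans (Finset.sum_congr rfl fun f _ => ?_)
  exact (detRowAlternating (n := m) (R := R)).toMultilinearMap.map_smul_univ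
    (fun i => A i (f i)) fun i => B (f i)

/-- The Cauchy-Binet formula, with the minors indexed by all maps. -/
theorem card_perm_mul_det_mul (A : Matrix m n R) (B : Matrix n m R) :
    (Fintype.card (Equiv.Perm m) : R) * (A * B).det =
      ∑ f : m → n, (A.submatrix id f).det * (B.submatrix f id).det := by
  -- Reindexing by `f ↦ f ∘ σ` permutes the rows of the minor of `B` and costs `sign σ`. Summing
  -- over all `σ` then assembles the minor of `A`, at the price of the factor `|m|!`.
  have h (σ : Equiv.Perm m) : (A * B).det = ∑ f : m → n,
      (Equiv.Perm.sign σ * ∏ i, A i (f (σ i)) : R) * (B.submatrix f id).det := by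
    rw [det_mul_eq_sum_prod_mul_det, ← (Equiv.arrowCongr σ⁻¹ (Equiv.refl n)).sum_comp]
    refine Finset.sum_congr rfl fun f _ => ?_
    have h1 := det_permute σ (B.submatrix f id)
    rw [submatrix_submatrix] at h1
    have h2 : (Equiv.arrowCongr σ⁻¹ (Equiv.refl n)) f = f ∘ σ := by
      rfl
    rw [h2]
    erw [h1]
    simp only [Function.comp_apply]
    ring
  calc _ = ∑ σ : Equiv.Perm m, (A * B).det := by simp
    _ = ∑ f : m → n, ∑ σ : Equiv.Perm m,
        (Equiv.Perm.sign σ * ∏ i, A i (f (σ i)) : R) * (B.submatrix f id).det := by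
      rw [Finset.sum_comm]
      exact Finset.sum_congr rfl fun σ _ => h σ
    _ = _ := by
      refine Finset.sum_congr rfl fun f _ => ?_
      rw [← Finset.sum_mul, ← det_transpose (A.submatrix id f), det_apply' (A.submatrix id f)ᵀ]
      rfl

end Matrix

/-- Such maps are a fixed bijection `m ≃ S` composed with permutations; this count matches the
factorial in `card_perm_mul_det_mul`. -/
theorem Fintype.card_injective_image_eq [DecidableEq n] (S : Finset n)
    (hS : S.card = Fintype.card m) :
    (Finset.univ.filter fun f : m → n => Function.Injective f ∧ Finset.univ.image f = S).card =
      Fintype.card (Equiv.Perm m) := by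
  have e : m ≃ S := Fintype.equivOfCardEq (by simp [hS])
  rw [← Finset.card_univ (α := Equiv.Perm m)]
  symm
  refine Finset.card_bij (fun σ _ i => (e (σ i) : n)) (fun σ _ => ?_) (fun σ _ τ _ h => ?_)
    fun f hf => ?_
  · refine Finset.mem_filter.2 ⟨Finset.mem_univ _,
      Subtype.val_injective.comp (e.injective.comp σ.injective), ?_⟩
    ext s
    refine ⟨fun h => ?_, fun h => ?_⟩
    · obtain ⟨i, -, rfl⟩ := Finset.mem_image.1 h
      exact (e (σ i)).2
    · exact Finset.mem_image.2 ⟨σ.symm (e.symm ⟨s, h⟩), Finset.mem_univ _, by simp⟩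
  · ext i
    exact e.injective (Subtype.ext (congrFun h i))
  · obtain ⟨-, hinj, him⟩ := Finset.mem_filter.1 hf
    have hmem (i : m) : f i ∈ S := him ▸ Finset.mem_image_of_mem f (Finset.mem_univ i)
    have hb : Function.Injective fun i => e.symm ⟨f i, hmem i⟩ := fun i j h =>
      hinj (congrArg Subtype.val (e.symm.injective h))
    refine ⟨Equiv.ofBijective _ (Finite.injective_iff_bijective.1 hb), Finset.mem_univ _, ?_⟩
    ext i
    simp

end CauchyBinet

/-! ### Units of Laurent polynomial rings -/

namespace LaurentPolynomial

open Polynomial in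
-- Clearing denominators in `u` and its inverse gives polynomials with product a power of the prime
-- `X`, so each is a unit times a power of `X`.
theorem exists_eq_C_mul_T_of_isUnit {R : Type*} [CommRing R] [IsDomain R] {u : R[T;T⁻¹]}
    (hu : IsUnit u) : ∃ (a : R) (n : ℤ), IsUnit a ∧ u = C a * T n := by
  obtain ⟨v, hv⟩ := hu.exists_right_inv
  obtain ⟨n, f, hf⟩ := exists_T_pow u
  obtain ⟨m, g, hg⟩ := exists_T_pow v
  have hfg : f * g = Polynomial.X ^ (n + m) := by
    apply Polynomial.toLaurent_injective
    rw [map_mul, hf, hg, Polynomial.toLaurent_X_pow, Nat.cast_add, T_add]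
    linear_combination T n * T m * hv
  obtain ⟨k, -, w, hw⟩ := (dvd_prime_pow Polynomial.prime_X (n + m)).1 ⟨g, hfg.symm⟩
  obtain ⟨a, ha, haw⟩ := Polynomial.isUnit_iff.1 (w⁻¹).isUnit
  have hf' : f = Polynomial.C a * Polynomial.X ^ k := by
    rw [haw, ← hw, mul_comm, mul_assoc, Units.mul_inv, mul_one]
  refine ⟨a, k - n, ha, ?_⟩
  rw [hf', Polynomial.toLaurent_C_mul_X_pow] at hf
  rw [T_sub, ← mul_assoc, hf, mul_T_assoc, add_neg_cancel, T_zero, mul_one]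

/-- Integrality matters: the leading constant is `±1`, so its square is `1`. -/
theorem invert_mul_self_of_isUnit {u : LaurentPolynomial ℤ} (hu : IsUnit u) :
    invert u * u = 1 := by
  obtain ⟨a, n, ha, rfl⟩ := exists_eq_C_mul_T_of_isUnit hu
  have h2 : a * a = 1 := by
    rcases Int.isUnit_iff.1 ha with rfl | rfl <;> rfl
  rw [map_mul, invert_C, invert_T]
  calc C a * T (-n) * (C a * T n) = C (a * a) * (T (-n) * T n) := by rw [map_mul]; ring
    _ = 1 := by rw [h2, ← T_add]; simp

end LaurentPolynomial

/-! ### The `q`-cut lattice and its determinant -/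

namespace OrientedMultigraph

open LaurentPolynomial

variable {V E : Type*} {Γ : OrientedMultigraph V E} {T : Finset E} [DecidableEq E] [Fintype E]

theorem eulerForm_gram {ι : Type*} (X : Matrix ι E (LaurentPolynomial ℤ)) :
    (Matrix.of fun i j => Γ.eulerForm T (X i) (X j)) =
      X.map invert * Γ.eulerGram T * X.transpose := by
  ext1 i j
  simp only [eulerForm, Matrix.of_apply, Matrix.mul_apply, Matrix.map_apply,
    Matrix.transpose_apply, Finset.sum_mul]
  exact Finset.sum_comm

/-- For the dual basis one factor `G⁻¹` cancels `G`; the other comes from the antilinear argument,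
hence transposed and with `q` inverted. -/
theorem eulerForm_simpleClass (e f : E) :
    Γ.eulerForm T (Γ.simpleClass T e) (Γ.simpleClass T f) = invert ((Γ.eulerGram T)⁻¹ f e) := by
  have h := congrFun (congrFun
    (eulerForm_gram (Γ := Γ) (T := T) ((Γ.eulerGram T)⁻¹).transpose) e) f
  rw [Matrix.mul_assoc, Matrix.transpose_transpose, Γ.eulerGram_mul_inv T, Matrix.mul_one] at h
  exact h

/-- As `N = halfGram` squares to zero, `(1 + N)⁻¹ = 1 - N`, and likewise for the transpose. -/
theorem inv_eulerGram (Γ : OrientedMultigraph V E) (T : Finset E) :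
    (Γ.eulerGram T)⁻¹ = (1 - Γ.halfGram T) * (1 - (Γ.halfGram T).transpose) := by
  have h1 : (1 + Γ.halfGram T) * (1 - Γ.halfGram T) = 1 := by
    rw [add_mul, mul_sub, mul_sub, Γ.halfGram_sq T]; simp
  have h2 : (1 + (Γ.halfGram T).transpose) * (1 - (Γ.halfGram T).transpose) = 1 := by
    rw [add_mul, mul_sub, mul_sub, ← Matrix.transpose_mul, Γ.halfGram_sq T]; simp
  refine Matrix.inv_eq_right_inv ?_
  rw [Γ.eulerGram_eq T, Matrix.mul_assoc, ← Matrix.mul_assoc (1 + Γ.halfGram T), h1,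
    Matrix.one_mul, h2]

theorem linearIndependent_simpleClass (Γ : OrientedMultigraph V E) (T : Finset E) :
    LinearIndependent (LaurentPolynomial ℤ) (Γ.simpleClass T) := by
  have h : Function.Injective ((Γ.eulerGram T)⁻¹).mulVec := by
    intro x y hxy
    have := congrArg (Γ.eulerGram T).mulVec hxy
    simpa [Matrix.mulVec_mulVec, Γ.eulerGram_mul_inv T] using this
  exact Matrix.mulVec_injective_iff.1 h

/-- The basis of the `q`-cut lattice given by the classes `[L_e]`. -/
noncomputable def qCutBasis (Γ : OrientedMultigraph V E) (T : Finset E) :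
    Module.Basis T (LaurentPolynomial ℤ) (Γ.qCutLattice T) :=
  (Module.Basis.span ((Γ.linearIndependent_simpleClass T).comp (Subtype.val : T → E)
    Subtype.val_injective)).map (LinearEquiv.ofEq _ _ (by
      rw [qCutLattice]
      congr 1
      ext x
      simp [eq_comm]))

theorem coe_qCutBasis (e : T) :
    (Γ.qCutBasis T e : E → LaurentPolynomial ℤ) = Γ.simpleClass T e := by
  simp [qCutBasis, Module.Basis.span_apply]

/-- The weight `1` on the edges of `T` and `q²` on the other edges. -/
noncomputable def edgeWeight (T : Finset E) (e : E) : LaurentPolynomial ℤ :=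
  if e ∈ T then 1 else LaurentPolynomial.T 2

/-- The matrix of the fundamental cuts. -/
noncomputable def cutMatrix (Γ : OrientedMultigraph V E) (T : Finset E) :
    Matrix T E (LaurentPolynomial ℤ) :=
  Matrix.of fun e e' => C (Γ.fundCut T e e')

omit [Fintype E] in
theorem prod_edgeWeight (T S : Finset E) :
    ∏ e ∈ S, edgeWeight T e = LaurentPolynomial.T (2 * ((S \ T).card : ℤ)) := by
  simp only [edgeWeight]
  rw [Finset.prod_ite, Finset.prod_const_one, one_mul, Finset.prod_const, ← Finset.sdiff_eq_filter,
    T_pow, mul_comm]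

namespace IsSpanningTree

/-- The edges of `T` contribute exactly `δ_ef` to `⟨K_e, K_f⟩`, which the `-1` on the diagonal
removes. -/
theorem qCutGram_apply (hT : Γ.IsSpanningTree T) (e f : T) :
    Γ.qCutGram T e f = (if e = f then 1 else 0) +
      ∑ j ∈ Tᶜ, C (Γ.fundCut T e j * Γ.fundCut T f j) * LaurentPolynomial.T 2 := by
  have h : Γ.fundCut T e ⬝ᵥ Γ.fundCut T f =
      (if e = f then 1 else 0) + ∑ j ∈ Tᶜ, Γ.fundCut T e j * Γ.fundCut T f j := by
    rw [dotProduct, ← Finset.sum_add_sum_compl T]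
    congr 1
    rw [Finset.sum_eq_single (e : E)]
    · rw [hT.fundCut_apply e.2 e.2, hT.fundCut_apply f.2 e.2]
      rw [if_pos rfl, one_mul]
      exact if_congr (eq_comm.trans Subtype.ext_iff.symm) rfl rfl
    · intro j hj hne
      rw [hT.fundCut_apply e.2 hj, if_neg hne.symm, zero_mul]
    · exact fun h => absurd e.2 h
  rw [← Finset.sum_mul, ← map_sum]
  unfold qCutGram
  by_cases hef : e = f
  · subst hef
    rw [if_pos rfl, if_pos rfl, h, if_pos rfl, add_sub_cancel_left]
  · rw [if_neg hef, if_neg hef, h, if_neg hef, zero_add, zero_add]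

theorem qCutGram_eq_mul (hT : Γ.IsSpanningTree T) :
    Γ.qCutGram T =
      Γ.cutMatrix T * (Matrix.diagonal (edgeWeight T) * (Γ.cutMatrix T).transpose) := by
  ext1 e f
  rw [hT.qCutGram_apply, Matrix.mul_apply, ← Finset.sum_add_sum_compl T]
  simp only [Matrix.diagonal_mul, Matrix.transpose_apply, cutMatrix, Matrix.of_apply]
  congr 1
  · rw [Finset.sum_eq_single (e : E)]
    · rw [hT.fundCut_apply e.2 e.2, hT.fundCut_apply f.2 e.2]
      by_cases h : e = f
      · simp [h, edgeWeight]
      · simp [h, Subtype.coe_ne_coe.2 (Ne.symm h)]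
    · intro j hj hne
      rw [hT.fundCut_apply e.2 hj, if_neg hne.symm, map_zero, zero_mul]
    · exact fun h => absurd e.2 h
  · refine Finset.sum_congr rfl fun j hj => ?_
    rw [edgeWeight, if_neg (Finset.mem_compl.1 hj), map_mul]
    ring

/-- In the `T`-block of `(1 - N)(1 - Nᵀ)` the linear terms vanish, since the columns of `N` indexed
by `T` are zero. In `N Nᵀ` the two signs of cut-cycle duality cancel. -/
theorem qCutGram_eq_inv_eulerGram (hT : Γ.IsSpanningTree T) (e f : T) :
    Γ.qCutGram T e f = (Γ.eulerGram T)⁻¹ f e := by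
  have h1 (i j : E) (hj : j ∈ T) : Γ.halfGram T i j = 0 := by simp [halfGram, hj]
  rw [hT.qCutGram_apply, Γ.inv_eulerGram T, sub_mul, one_mul, mul_sub, mul_one, Matrix.sub_apply,
    Matrix.sub_apply, Matrix.sub_apply, Matrix.transpose_apply, h1 _ _ f.2, h1 _ _ e.2, sub_zero,
    zero_sub, sub_neg_eq_add, Matrix.one_apply]
  congr 1
  · exact if_congr (eq_comm.trans Subtype.ext_iff) rfl rfl
  · rw [Matrix.mul_apply, ← Finset.sum_add_sum_compl T,
      Finset.sum_eq_zero (s := T) fun j hj => by rw [h1 f j hj, zero_mul], zero_add]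
    refine Finset.sum_congr rfl fun j hj => ?_
    have hj := Finset.mem_compl.1 hj
    have h2 (i : T) : Γ.halfGram T i j = -(C (Γ.fundCut T i j) * LaurentPolynomial.T 1) := by
      rw [halfGram, if_pos ⟨i.2, hj⟩, hT.bipSign_eq i.2 hj, map_neg, neg_mul]
    rw [Matrix.transpose_apply, h2, h2, map_mul, show (2 : ℤ) = 1 + 1 from rfl, T_add]
    ring

theorem invert_eulerForm_simpleClass (hT : Γ.IsSpanningTree T) (e f : T) :
    invert (Γ.eulerForm T (Γ.simpleClass T e) (Γ.simpleClass T f)) = Γ.qCutGram T e f := by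
  rw [eulerForm_simpleClass, hT.qCutGram_eq_inv_eulerGram, involutive_invert _]

open Classical in
/-- The determinant of the Gram matrix as a sum over the spanning trees. -/
theorem det_qCutGram (hT : Γ.IsSpanningTree T) :
    (Γ.qCutGram T).det = ∑ S with Γ.IsSpanningTree S,
      LaurentPolynomial.T (2 * ((S \ T).card : ℤ)) := by
  have hterm (f : T → E) : ((Γ.cutMatrix T).submatrix id f).det *
      ((Matrix.diagonal (edgeWeight T) * (Γ.cutMatrix T).transpose).submatrix f id).det =
      if Function.Injective f ∧ Γ.IsSpanningTree (Finset.univ.image f) then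
        LaurentPolynomial.T (2 * ((Finset.univ.image f \ T).card : ℤ)) else 0 := by
    have h1 : ((Γ.cutMatrix T).submatrix id f).det =
        C (Matrix.of fun e t : T => Γ.fundCut T e (f t)).det := by
      rw [RingHom.map_det]
      rfl
    have h2 : (Matrix.diagonal (edgeWeight T) * (Γ.cutMatrix T).transpose).submatrix f id =
        Matrix.of fun i j => edgeWeight T (f i) * ((Γ.cutMatrix T).submatrix id f).transpose i j := by
      ext1 i j
      simp
    rw [h2, Matrix.det_mul_column, Matrix.det_transpose, h1, mul_left_comm, ← map_mul, ← sq,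
      hT.sq_det_fundCut f]
    split_ifs with h
    · rw [map_one, mul_one, ← prod_edgeWeight, Finset.prod_image h.1.injOn]
    · rw [map_zero, mul_zero]
  -- The factorial from Cauchy-Binet is nonzero and can be cancelled.
  have hcard : (Fintype.card (Equiv.Perm T) : LaurentPolynomial ℤ) ≠ 0 :=
    fun h => by
      have h := (map_natCast (C (R := ℤ)) _).trans h
      have h0 := degree_C (R := ℤ) (Nat.cast_ne_zero.2 (Fintype.card_ne_zero (α := Equiv.Perm T)))
      rw [h, degree_zero] at h0
      exact WithBot.bot_ne_zero h0
  refine mul_left_cancel₀ hcard ?_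
  rw [hT.qCutGram_eq_mul, Matrix.card_perm_mul_det_mul, Finset.sum_congr rfl fun f _ => hterm f,
    ← Finset.sum_filter, Finset.mul_sum,
    ← Finset.sum_fiberwise_of_maps_to (t := Finset.univ.filter Γ.IsSpanningTree)
      (g := fun f => Finset.univ.image f)]
  · refine Finset.sum_congr rfl fun S hS => ?_
    have hS := (Finset.mem_filter.1 hS).2
    rw [← Fintype.card_injective_image_eq S (by rw [hT.card_eq hS, Fintype.card_coe]),
      ← nsmul_eq_mul, ← Finset.sum_const, Finset.filter_filter]
    refine Finset.sum_congr ?_ fun f hf => by rw [(Finset.mem_filter.1 hf).2.2]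
    ext f
    simp only [Finset.mem_filter, Finset.mem_univ, true_and]
    exact ⟨fun h => ⟨h.1.1, h.2⟩, fun h => ⟨⟨h.1, h.2 ▸ hS⟩, h.2⟩⟩
  · intro f hf
    exact Finset.mem_filter.2 ⟨Finset.mem_univ _, (Finset.mem_filter.1 hf).2.2⟩

theorem det_qCutGram_eq_sum_treeCount (hT : Γ.IsSpanningTree T) :
    (Γ.qCutGram T).det =
      ∑ i ∈ Finset.range (T.card + 1), (Γ.treeCount T i : LaurentPolynomial ℤ) *
        LaurentPolynomial.T (2 * (i : ℤ)) := by
  classical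
  -- Since `S` and `T` have the same size, the exponent `|S ∖ T|` is the `i` of `treeCount`.
  have hS {S : Finset E} (hS : Γ.IsSpanningTree S) : (S ∩ T).card + (S \ T).card = T.card := by
    rw [Finset.card_inter_add_card_sdiff, hT.card_eq hS]
  rw [hT.det_qCutGram, ← Finset.sum_fiberwise_of_maps_to (t := Finset.range (T.card + 1))
    (g := fun S => (S \ T).card)]
  · refine Finset.sum_congr rfl fun i _ => ?_
    have hcount : Γ.treeCount T i = ((Finset.univ.filter Γ.IsSpanningTree).filter
        fun S => (S \ T).card = i).card := by
      refine (congrArg Set.ncard ?_).trans (Set.ncard_coe_finset _)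
      ext S
      simp only [Set.mem_ofPred_eq, Finset.coe_filter, Finset.mem_filter, Finset.mem_univ, true_and]
      refine and_congr_right fun h => ?_
      have := hS h
      omega
    rw [hcount, ← nsmul_eq_mul, ← Finset.sum_const]
    exact Finset.sum_congr rfl fun S h => by rw [(Finset.mem_filter.1 h).2]
  · intro S h
    have := hS (Finset.mem_filter.1 h).2
    exact Finset.mem_range.2 (by omega)

omit [Fintype E] in
theorem treeCount_zero (hT : Γ.IsSpanningTree T) : Γ.treeCount T 0 = 1 := by
  rw [treeCount, Set.ncard_eq_one]
  refine ⟨T, Set.eq_singleton_iff_unique_mem.2 ⟨⟨hT, by simp⟩, fun S hS => ?_⟩⟩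
  refine hT.eq_of_subset hS.1 ?_
  rw [← Finset.inter_eq_right]
  exact Finset.eq_of_subset_of_card_le Finset.inter_subset_right hS.2.ge

end IsSpanningTree

/-- The determinant of the form does not depend on the basis. -/
theorem det_eulerForm_basis {ι κ : Type*} [Fintype ι] [DecidableEq ι] [Fintype κ] [DecidableEq κ]
    {L : Submodule (LaurentPolynomial ℤ) (E → LaurentPolynomial ℤ)}
    (b : Module.Basis ι (LaurentPolynomial ℤ) L) (c : Module.Basis κ (LaurentPolynomial ℤ) L) :
    (Matrix.of fun i j : ι => Γ.eulerForm T (b i) (b j)).det =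
      (Matrix.of fun i j : κ => Γ.eulerForm T (c i) (c j)).det := by
  -- Bases of the same lattice have equipotent index types, so both can be indexed by `κ`.
  set e := c.indexEquiv b
  have hsub : (Matrix.of fun i j : ι => Γ.eulerForm T (b i) (b j)).submatrix e e =
      Matrix.of fun i j : κ =>
        Γ.eulerForm T (b.reindex e.symm i) (b.reindex e.symm j) := by
    ext1 i j
    simp
  rw [← Matrix.det_submatrix_equiv_self e, hsub]
  set d := b.reindex e.symm
  set P := (c.toMatrix d).transpose with hP
  have hX : (fun i => (d i : E → LaurentPolynomial ℤ)) =
      P * (Matrix.of fun i => (c i : E → LaurentPolynomial ℤ)) := by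
    ext1 i
    have h := congrArg Subtype.val (c.sum_toMatrix_smul_self d i)
    rw [Submodule.coe_sum] at h
    rw [← h]
    ext1 j
    rw [Matrix.mul_apply, Finset.sum_apply]
    rfl
  have hg (X : Matrix κ E (LaurentPolynomial ℤ)) :=
    congrArg Matrix.det (eulerForm_gram (Γ := Γ) (T := T) X)
  refine (hg fun i => (d i : E → LaurentPolynomial ℤ)).trans
    (Eq.trans ?_ (hg fun i => (c i : E → LaurentPolynomial ℤ)).symm)
  -- The base change contributes `invert P.det * P.det`, which is `1` for a unit.
  have hu : IsUnit P.det := by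
    rw [hP, Matrix.det_transpose, ← c.det_apply]
    exact c.isUnit_det d
  have hmap : (P.map invert).det = invert P.det :=
    (RingHom.map_det (invert (R := ℤ)).toRingEquiv.toRingHom P).symm
  rw [hX]
  set M : Matrix κ E (LaurentPolynomial ℤ) :=
    Matrix.of fun i => (c i : E → LaurentPolynomial ℤ)
  calc _ = (P.map invert * (M.map invert * Γ.eulerGram T * M.transpose) * P.transpose).det := by
        rw [Matrix.transpose_mul, Matrix.map_mul]
        simp only [Matrix.mul_assoc]
    _ = invert P.det * P.det * (M.map invert * Γ.eulerGram T * M.transpose).det := by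
        rw [Matrix.det_mul, Matrix.det_mul, Matrix.det_transpose, hmap]
        ring
    _ = _ := by
        rw [invert_mul_self_of_isUnit hu, one_mul]
        rfl

end OrientedMultigraph
/-- The `q`-matrix-tree theorem. -/
theorem mainTheorem2 {V E : Type*} [Fintype V] [Fintype E] [DecidableEq E]
    (Γ : OrientedMultigraph V E) (T : Finset E) (hT : Γ.IsSpanningTree T) :
    -- the determinant of the combinatorial Gram matrix of the `q`-cut lattice
    (Γ.qCutGram T).det =
        ∑ i ∈ Finset.range (T.card + 1), (Γ.treeCount T i : LaurentPolynomial ℤ) *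
          LaurentPolynomial.T (2 * (i : ℤ)) ∧
    -- the classes `[L_e]`, `e ∈ T`, are a basis of the `q`-cut lattice, with this Gram matrix
    (∃ b : Module.Basis T (LaurentPolynomial ℤ) (Γ.qCutLattice T),
      (∀ e : T, (b e : E → LaurentPolynomial ℤ) = Γ.simpleClass T e) ∧
      ∀ e f : T, LaurentPolynomial.invert (Γ.eulerForm T (b e) (b f)) = Γ.qCutGram T e f) ∧
    -- the determinant of the `q`-cut lattice, computed in any basis
    (∀ (ι : Type*) [Fintype ι] [DecidableEq ι]
        (b : Module.Basis ι (LaurentPolynomial ℤ) (Γ.qCutLattice T)),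
      LaurentPolynomial.invert
          (Matrix.of fun i j : ι => Γ.eulerForm T (b i) (b j)).det =
        ∑ i ∈ Finset.range (T.card + 1), (Γ.treeCount T i : LaurentPolynomial ℤ) *
          LaurentPolynomial.T (2 * (i : ℤ))) ∧
    Γ.treeCount T 0 = 1 := by
  have hb (e : T) := OrientedMultigraph.coe_qCutBasis (Γ := Γ) e
  have hgram (e f : T) : LaurentPolynomial.invert
      (Γ.eulerForm T (Γ.qCutBasis T e) (Γ.qCutBasis T f)) = Γ.qCutGram T e f := by
    rw [hb, hb, hT.invert_eulerForm_simpleClass]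
  refine ⟨hT.det_qCutGram_eq_sum_treeCount, ⟨Γ.qCutBasis T, hb, hgram⟩, ?_, hT.treeCount_zero⟩
  intro ι _ _ b
  rw [OrientedMultigraph.det_eulerForm_basis b (Γ.qCutBasis T),
    ← hT.det_qCutGram_eq_sum_treeCount, AlgEquiv.map_det]
  congr 1
  ext1 e f
  exact hgram e f
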